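/- For a finite poset $P=(X,\preceq)$ with at least two elements, a linear extension of $P$ is an order-preserving bijection $L\colon X\to\{1,\dots,|X|\}$, and the sorting probability of $P$ is $$\delta(P) \;=\; \min_{x,y\in X,\ x\neq y}\ \bigl|\,\mathbf{P}[L(x)\le L(y)]-\mathbf{P}[L(y)\le L(x)]\,\bigr|,$$ where $L$ is a uniformly random linear extension of $P$. For $n\ge 1$, let $P_n=C_2\times C_n$ be the Catalan poset, i.e. the product, with the componentwise order, of a chain with $2$ elements and a chain with $n$ elements. Then $$\delta(P_n)=O\bigl(n^{-5/4}\bigr)\qquad\text{as } n\to\infty .$$ -/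

import Mathlib

/-- Linear extensions of a finite poset `X`: order-preserving bijections of `X` onto the chain
with `|X|` elements (labelled `0, …, |X| - 1`). -/
def PosetLinearExtension (X : Type*) [PartialOrder X] [Fintype X] : Type _ :=
  {L : X ≃ Fin (Fintype.card X) // Monotone L}

/-- The probability that `L x ≤ L y`, for `L` a uniformly random linear extension of `X`. -/
noncomputable def probLE {X : Type*} [PartialOrder X] [Fintype X] (x y : X) : ℝ :=
  (Nat.card {L : PosetLinearExtension X // L.1 x ≤ L.1 y} : ℝ) /
    (Nat.card (PosetLinearExtension X) : ℝ)

/-- The sorting probability of a finite poset: the minimum of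
`|P[L x ≤ L y] - P[L y ≤ L x]|` over all pairs of distinct elements `x`, `y`. If `X` has at least
two elements, this is an infimum over a finite nonempty set, hence a minimum. -/
noncomputable def sortingProbability (X : Type*) [PartialOrder X] [Fintype X] : ℝ :=
  ⨅ p : {p : X × X // p.1 ≠ p.2}, |probLE p.1.1 p.1.2 - probLE p.1.2 p.1.1|

/-- The Catalan poset `C₂ × Cₙ`, with the product (componentwise) order. -/
abbrev CatalanPoset (n : ℕ) : Type := Fin 2 × Fin n

/-! Linear extensions of `CatalanPoset n` are Dyck walks of length 2n: chain 0 supplies the up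
steps, chain 1 the down steps. If a = b + 1 + k, then (1, b) precedes (0, a) exactly when the walk
has height at most k after a + b + 1 steps (`PosetLinearExtension.down_le_up_iff`). So it suffices
to find k and j for which `cumProb n k j`, the probability of height at most k after n + 2j steps,
is 1/2 + O(n^(-5/4)).

The choice of k is the coarse tuning: just below the median height at time n, k has order √n and the
probability falls short of 1/2 by O(n^(-1/2)) (`exists_near_median`). The cut time is the fine
tuning. By a discrete Green identity the increment in j is an exact boundary term, proportional to
the difference of the lengths of the two pieces (`splitCount_sub_mul`); it has order j/n²
(`cumProb_sub_bounds`). The total gain has order j²/n², so 1/2 is crossed at some j = O(n^(3/4)),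
and the overshoot is at most the last increment, O(n^(3/4)/n²) = O(n^(-5/4)).

All estimates rest on exact ratios of ballot numbers, without asymptotic formulas. -/

/-! ### Ballot numbers and their ratios. -/

/-- The number of `±1` walks of length `t` from height `x` to height `0` that stay nonnegative. -/
def walkCount : ℕ → ℕ → ℕ
  | 0, 0 => 1
  | 0, _ + 1 => 0
  | t + 1, 0 => walkCount t 1
  | t + 1, x + 1 => walkCount t (x + 2) + walkCount t x

theorem walkCount_eq_zero_of_lt {t x : ℕ} (h : t < x) : walkCount t x = 0 := by
  induction t generalizing x with
  | zero => cases x with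
    | zero => omega
    | succ x => rfl
  | succ t ih => cases x with
    | zero => omega
    | succ x => simp only [walkCount, ih (show t < x + 2 by omega), ih (show t < x by omega)]

theorem walkCount_eq_zero_of_odd {t x : ℕ} (h : (t + x) % 2 = 1) : walkCount t x = 0 := by
  induction t generalizing x with
  | zero => cases x with
    | zero => omega
    | succ x => rfl
  | succ t ih => cases x with
    | zero => simp only [walkCount, ih (show (t + 1) % 2 = 1 by omega)]
    | succ x => simp only [walkCount, ih (show (t + (x + 2)) % 2 = 1 by omega),
        ih (show (t + x) % 2 = 1 by omega)]

theorem walkCount_pos {t x : ℕ} (h : x ≤ t) (h2 : (t + x) % 2 = 0) : 0 < walkCount t x := by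
  induction t generalizing x with
  | zero =>
    obtain rfl : x = 0 := by omega
    simp [walkCount]
  | succ t ih => cases x with
    | zero => exact ih (by omega) (by omega)
    | succ x =>
      have := ih (x := x) (by omega) (by omega)
      simp only [walkCount]
      omega

/-- Ratio of neighbouring ballot numbers, cleared of denominators so that it also holds for wrong
parity and beyond the reach of the walk. In the induction both counts at time t + 1 are expressed
through the middle one, `walkCount t (k + 1)`. -/
theorem walkCount_add_two_mul (t k : ℕ) :
    ((k : ℝ) + 1) * (t + k + 4) * walkCount t (k + 2) = (k + 3) * (t - k) * walkCount t k := by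
  induction t generalizing k with
  | zero => cases k <;> simp [walkCount]
  | succ t ih =>
    have hk : ((k : ℝ) + 2) ≠ 0 := by positivity
    have up : ((k : ℝ) + 2) * (t + k + 5) * walkCount (t + 1) (k + 2)
        = 2 * (k + 3) * (t + 1) * walkCount t (k + 1) := by
      have h := ih (k + 1)
      simp only [walkCount]
      push_cast at h ⊢
      linear_combination h
    have down : ((k : ℝ) + 2) * (t + 1 - k) * walkCount (t + 1) k
        = 2 * (k + 1) * (t + 1) * walkCount t (k + 1) := by
      cases k with
      | zero => simp only [walkCount]; push_cast; ring
      | succ k =>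
        have h := ih k
        simp only [walkCount]
        push_cast at h ⊢
        linear_combination -h
    apply mul_left_cancel₀ hk
    push_cast
    linear_combination (k + 1) * up - (k + 3) * down

theorem walkCount_succ_succ_mul (t k : ℕ) :
    ((k : ℝ) + 1) * (t + k + 4) * walkCount (t + 1) (k + 1)
      = 2 * (k + 2) * (t + 1) * walkCount t k := by
  have h := walkCount_add_two_mul t k
  simp only [walkCount]
  push_cast at h ⊢
  linear_combination h

theorem walkCount_succ_mul (t k : ℕ) :
    ((k : ℝ) + 2) * (t + 1 - k) * walkCount (t + 1) k
      = 2 * (k + 1) * (t + 1) * walkCount t (k + 1) := by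
  cases k with
  | zero => simp only [walkCount]; push_cast; ring
  | succ k =>
    have h := walkCount_add_two_mul t k
    simp only [walkCount]
    push_cast at h ⊢
    linear_combination -h

theorem walkCount_add_two_left_mul (t k : ℕ) :
    ((t : ℝ) + 2 - k) * (t + k + 4) * walkCount (t + 2) k
      = 4 * (t + 1) * (t + 2) * walkCount t k := by
  have h1 := walkCount_succ_succ_mul t k
  have h2 := walkCount_succ_mul (t + 1) k
  have hk : ((k : ℝ) + 1) * (k + 2) ≠ 0 := by positivity
  apply mul_left_cancel₀ hk
  push_cast at h2
  rw [add_assoc t 1 1] at h2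
  norm_num at h2
  linear_combination (k + 1) * (t + k + 4) * h2 + 2 * (k + 1) * (t + 2) * h1

/-! ### Cutting a closed walk in two: flux through height k. -/

/-- The number of nonnegative closed walks of length `t + s` at `0` whose height after `t` steps
is at most `k`. -/
def splitCount (t s k : ℕ) : ℕ := ∑ z ∈ Finset.range (k + 1), walkCount t z * walkCount s z

/-- Discrete Green identity. -/
theorem splitCount_succ_left (t s k : ℕ) :
    splitCount (t + 1) s k + walkCount t k * walkCount s (k + 1)
      = splitCount t (s + 1) k + walkCount t (k + 1) * walkCount s k := by
  unfold splitCount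
  induction k with
  | zero => simp [walkCount]; ring
  | succ k ih =>
    rw [Finset.sum_range_succ, Finset.sum_range_succ _ (k + 1)]
    simp only [walkCount] at ih ⊢
    linear_combination ih

/-- Two applications of the Green identity; by parity each one loses one of its two boundary terms.
-/
theorem splitCount_add_two (t s k : ℕ) (ht : (t + k) % 2 = 0) :
    splitCount (t + 2) s k + walkCount t k * walkCount (s + 1) (k + 1)
      = splitCount t (s + 2) k + walkCount (t + 1) (k + 1) * walkCount s k := by
  have h1 := splitCount_succ_left (t + 1) s k
  have h2 := splitCount_succ_left t (s + 1) k
  rw [walkCount_eq_zero_of_odd (t := t + 1) (x := k) (by omega)] at h1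
  rw [walkCount_eq_zero_of_odd (t := t) (x := k + 1) (by omega)] at h2
  linarith

/-- When k is beyond the reach of both pieces the boundary terms vanish, so steps move freely from
one piece to the other. -/
theorem splitCount_eq_of_le (t s k : ℕ) (h : t + s ≤ k) :
    splitCount t s k = walkCount (t + s) 0 := by
  induction s generalizing t with
  | zero =>
    unfold splitCount
    rw [Finset.sum_eq_single 0]
    · simp [walkCount]
    · intro z _ hz
      rw [walkCount_eq_zero_of_lt (t := 0) (by omega)]
      simp
    · simp
  | succ s ih =>
    have h1 := splitCount_succ_left t s k
    rw [walkCount_eq_zero_of_lt (t := s) (x := k + 1) (by omega),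
      walkCount_eq_zero_of_lt (t := t) (x := k + 1) (by omega), ih (t + 1) (by omega)] at h1
    rw [show t + (s + 1) = t + 1 + s by ring]
    linarith

theorem splitCount_eq_of_left_le {t s k : ℕ} (h : t ≤ k) :
    splitCount t s k = walkCount (t + s) 0 := by
  rw [← splitCount_eq_of_le t s (k + s) (by omega)]
  unfold splitCount
  apply Finset.sum_subset
  · intro z; simp only [Finset.mem_range]; omega
  · intro z _ hz
    rw [walkCount_eq_zero_of_lt (t := t) (by simp only [Finset.mem_range] at hz; omega)]
    simp

/-! ### Walks as lists of steps. -/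

/-- `IsWalk l x y`: the walk with steps `l` (`true` is up, `false` is down) leads from height `x`
to height `y` and stays nonnegative. -/
def IsWalk : List Bool → ℕ → ℕ → Prop
  | [], x, y => x = y
  | true :: l, x, y => IsWalk l (x + 1) y
  | false :: _, 0, _ => False
  | false :: l, x + 1, y => IsWalk l x y

theorem isWalk_iff (l : List Bool) (x y : ℕ) :
    IsWalk l x y ↔ (∀ t, (l.take t).count false ≤ x + (l.take t).count true) ∧
      x + l.count true = y + l.count false := by
  induction l generalizing x with
  | nil => simp [IsWalk]
  | cons b l ih =>
    cases b with
    | true =>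
      simp only [IsWalk, ih]
      refine and_congr ⟨fun h t => ?_, fun h t => ?_⟩ ?_
      · cases t with
        | zero => simp
        | succ t => have := h t; simp; omega
      · have := h (t + 1); simp at this; omega
      · simp; omega
    | false =>
      cases x with
      | zero =>
        simp only [IsWalk, false_iff]
        rintro ⟨h, -⟩
        have := h 1
        simp at this
      | succ x =>
        simp only [IsWalk, ih]
        refine and_congr ⟨fun h t => ?_, fun h t => ?_⟩ ?_
        · cases t with
          | zero => simp
          | succ t => have := h t; simp; omega
        · have := h (t + 1); simp at this; omega
        · simp; omega

theorem isWalk_append (l₁ l₂ : List Bool) (x y : ℕ) :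
    IsWalk (l₁ ++ l₂) x y ↔ ∃ z, IsWalk l₁ x z ∧ IsWalk l₂ z y := by
  induction l₁ generalizing x with
  | nil => simp [IsWalk]
  | cons b l ih =>
    cases b with
    | true => simpa [IsWalk] using ih (x + 1)
    | false => cases x with
      | zero => simp [IsWalk]
      | succ x => simpa [IsWalk] using ih x

theorem IsWalk.unique {l : List Bool} {x y z : ℕ} (h : IsWalk l x y) (h' : IsWalk l x z) :
    y = z := by
  have h1 := ((isWalk_iff _ _ _).1 h).2
  have h2 := ((isWalk_iff _ _ _).1 h').2
  omega

/-- The walk traversed backwards. -/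
def reverseWalk (l : List Bool) : List Bool := (l.map not).reverse

theorem reverseWalk_reverseWalk (l : List Bool) : reverseWalk (reverseWalk l) = l := by
  simp [reverseWalk, List.map_reverse, Function.comp_def]

theorem length_reverseWalk (l : List Bool) : (reverseWalk l).length = l.length := by
  simp [reverseWalk]

theorem IsWalk.reverse {l : List Bool} {x y : ℕ} (h : IsWalk l x y) :
    IsWalk (reverseWalk l) y x := by
  induction l generalizing x with
  | nil => exact Eq.symm h
  | cons b l ih =>
    have e : reverseWalk (b :: l) = reverseWalk l ++ [!b] := by simp [reverseWalk]
    rw [e, isWalk_append]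
    cases b with
    | true => exact ⟨x + 1, ih h, by simp [IsWalk]⟩
    | false => cases x with
      | zero => exact h.elim
      | succ x => exact ⟨x, ih h, by simp [IsWalk]⟩

/-- The nonnegative walks of length `t` from height `x` to height `0`. -/
def walks : ℕ → ℕ → Finset (List Bool)
  | 0, 0 => {[]}
  | 0, _ + 1 => ∅
  | t + 1, 0 => (walks t 1).map ⟨List.cons true, List.cons_injective⟩
  | t + 1, x + 1 => (walks t (x + 2)).map ⟨List.cons true, List.cons_injective⟩ ∪
      (walks t x).map ⟨List.cons false, List.cons_injective⟩

theorem mem_walks {t x : ℕ} {l : List Bool} :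
    l ∈ walks t x ↔ l.length = t ∧ IsWalk l x 0 := by
  induction t generalizing x l with
  | zero =>
    cases x with
    | zero => cases l <;> simp [walks, IsWalk]
    | succ x => cases l <;> simp [walks, IsWalk]
  | succ t ih =>
    cases x with
    | zero => rcases l with _ | ⟨_ | _, l⟩ <;> simp [walks, IsWalk, ih]
    | succ x => rcases l with _ | ⟨_ | _, l⟩ <;> simp [walks, IsWalk, ih]

theorem card_walks (t x : ℕ) : (walks t x).card = walkCount t x := by
  induction t generalizing x with
  | zero => cases x <;> simp [walks, walkCount]
  | succ t ih =>
    cases x with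
    | zero => simp [walks, walkCount, ih]
    | succ x =>
      rw [walks, Finset.card_union_of_disjoint, Finset.card_map, Finset.card_map, ih, ih, walkCount]
      rw [Finset.disjoint_left]
      simp

/-- Cut at time t and reverse the first piece: both pieces then run from z to 0, so a single family
of counts suffices. -/
theorem card_walks_through (t s z : ℕ) [DecidablePred fun l => IsWalk (List.take t l) 0 z] :
    ((walks (t + s) 0).filter fun l => IsWalk (l.take t) 0 z).card
      = walkCount t z * walkCount s z := by
  rw [← card_walks, ← card_walks, ← Finset.card_product]
  refine Finset.card_nbij' (fun l => (reverseWalk (l.take t), l.drop t))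
    (fun p => reverseWalk p.1 ++ p.2) ?_ ?_ ?_ ?_
  · intro l hl
    simp only [Finset.coe_filter, mem_walks, Set.mem_ofPred_eq] at hl
    obtain ⟨⟨h1, h2⟩, h3⟩ := hl
    simp only [Finset.coe_product, Set.mem_prod, Finset.mem_coe, mem_walks, length_reverseWalk]
    refine ⟨⟨by simp; omega, h3.reverse⟩, by simp; omega, ?_⟩
    rw [← List.take_append_drop t l, isWalk_append] at h2
    obtain ⟨z', h4, h5⟩ := h2
    rwa [h3.unique h4]
  · rintro ⟨l₁, l₂⟩ hl
    simp only [Finset.coe_product, Set.mem_prod, Finset.mem_coe, mem_walks] at hl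
    obtain ⟨⟨h1, h2⟩, h3, h4⟩ := hl
    have h5 : (reverseWalk l₁).length = t := by rw [length_reverseWalk, h1]
    simp only [Finset.coe_filter, mem_walks, Set.mem_ofPred_eq]
    rw [List.take_left' h5, isWalk_append]
    exact ⟨⟨by simp [h5, h3], z, h2.reverse, h4⟩, h2.reverse⟩
  · intro l hl
    simp [reverseWalk_reverseWalk]
  · rintro ⟨l₁, l₂⟩ hl
    simp only [Finset.coe_product, Set.mem_prod, Finset.mem_coe, mem_walks] at hl
    have h5 : (reverseWalk l₁).length = t := by rw [length_reverseWalk, hl.1.1]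
    simp [List.take_left' h5, List.drop_left' h5, reverseWalk_reverseWalk]

open Classical in
theorem card_walks_below (t s k : ℕ) :
    ((walks (t + s) 0).filter fun l => ∃ z ≤ k, IsWalk (l.take t) 0 z).card
      = splitCount t s k := by
  have : ((walks (t + s) 0).filter fun l => ∃ z ≤ k, IsWalk (l.take t) 0 z)
      = (Finset.range (k + 1)).biUnion
        fun z => (walks (t + s) 0).filter fun l => IsWalk (l.take t) 0 z := by
    ext l
    simp only [Finset.mem_filter, Finset.mem_biUnion, Finset.mem_range, Nat.lt_succ_iff]
    tauto
  rw [this, Finset.card_biUnion]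
  · exact Finset.sum_congr rfl fun z _ => card_walks_through t s z
  · intro z _ z' _ hz
    refine Finset.disjoint_left.2 ?_
    intro l h1 h2
    simp only [Finset.mem_filter] at h1 h2
    exact hz (h1.2.unique h2.2)

/-! ### Linear extensions of the Catalan poset as Dyck words. -/

theorem lt_card_filter_lt_iff {n : ℕ} {f : Fin n → ℕ} (hf : Monotone f) (t : ℕ) (a : Fin n) :
    (a : ℕ) < (Finset.univ.filter fun a' => f a' < t).card ↔ f a < t := by
  constructor
  · intro h
    by_contra hlt
    have : (Finset.univ.filter fun a' => f a' < t) ⊆ Finset.Iio a := by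
      intro a' ha'
      simp only [Finset.mem_filter, Finset.mem_univ, true_and] at ha'
      rw [Finset.mem_Iio]
      by_contra hle
      exact hlt ((hf (not_lt.1 hle)).trans_lt ha')
    have := Finset.card_le_card this
    rw [Fin.card_Iio] at this
    omega
  · intro h
    have : Finset.Iic a ⊆ (Finset.univ.filter fun a' => f a' < t) := by
      intro a' ha'
      simp only [Finset.mem_filter, Finset.mem_univ, true_and]
      exact (hf (Finset.mem_Iic.1 ha')).trans_lt h
    have := Finset.card_le_card this
    rw [Fin.card_Iic] at this
    omega

theorem count_take_succ {α : Type*} [DecidableEq α] (l : List α) (c : α) (t : ℕ)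
    (ht : t < l.length) :
    (l.take (t + 1)).count c = (l.take t).count c + if l[t] = c then 1 else 0 := by
  rw [List.take_add_one, List.getElem?_eq_getElem ht, List.count_append]
  simp [List.count_singleton]

theorem count_take_ofFn {N : ℕ} {α : Type*} [DecidableEq α] (f : Fin N → α) (c : α) (t : ℕ) :
    ((List.ofFn f).take t).count c
      = (Finset.univ.filter fun i : Fin N => (i : ℕ) < t ∧ f i = c).card := by
  induction t with
  | zero => simp
  | succ t ih =>
    by_cases ht : t < N
    · rw [count_take_succ _ _ _ (by simpa using ht), ih]
      have : (Finset.univ.filter fun i : Fin N => (i : ℕ) < t + 1 ∧ f i = c)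
          = (Finset.univ.filter fun i : Fin N => (i : ℕ) < t ∧ f i = c) ∪
            (if f ⟨t, ht⟩ = c then {⟨t, ht⟩} else ∅) := by
        ext i
        by_cases hi : i = ⟨t, ht⟩
        · subst hi
          by_cases hc : f ⟨t, ht⟩ = c <;> simp [hc]
        · have hi' : (i : ℕ) ≠ t := fun h => hi (Fin.ext h)
          have : (i : ℕ) ≤ t ↔ (i : ℕ) < t := by omega
          by_cases hc : f ⟨t, ht⟩ = c <;> simp [hc, hi, this]
      rw [this, Finset.card_union_of_disjoint]
      · by_cases hc : f ⟨t, ht⟩ = c <;> simp [hc]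
      · by_cases hc : f ⟨t, ht⟩ = c <;> simp [hc]
    · rw [List.take_of_length_le (by simp; omega)] at ih ⊢
      rw [ih]
      congr 1
      ext i
      have := i.2
      simp only [Finset.mem_filter, Finset.mem_univ, true_and]
      constructor <;> rintro ⟨-, h⟩ <;> exact ⟨by omega, h⟩

theorem card_catalanPoset (n : ℕ) : Fintype.card (CatalanPoset n) = n + n := by
  simp [Fintype.card_prod]; ring

/-- The chain of `CatalanPoset n` whose elements are the up steps (`true`) or the down steps
(`false`) of the associated walk. -/
def stepRow : Bool → Fin 2
  | true => 0
  | false => 1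

namespace PosetLinearExtension

variable {n : ℕ}

/-- The closed walk whose `i`-th step records the chain containing the `i`-th element of `L`. -/
def word (L : PosetLinearExtension (CatalanPoset n)) : List Bool :=
  List.ofFn fun i => decide ((L.1.symm i).1 = 0)

theorem length_word (L : PosetLinearExtension (CatalanPoset n)) : L.word.length = n + n := by
  rw [word, List.length_ofFn, card_catalanPoset]

theorem count_take_word (L : PosetLinearExtension (CatalanPoset n)) (c : Bool) (t : ℕ) :
    (L.word.take t).count c
      = (Finset.univ.filter fun a : Fin n => (L.1 (stepRow c, a) : ℕ) < t).card := by
  rw [word, count_take_ofFn]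
  symm
  refine Finset.card_bij (fun a _ => L.1 (stepRow c, a)) ?_ ?_ ?_
  · intro a ha
    simp only [Finset.mem_filter, Finset.mem_univ, true_and] at ha ⊢
    refine ⟨ha, ?_⟩
    cases c <;> simp [stepRow]
  · intro a _ a' _ h
    simpa using h
  · intro i hi
    simp only [Finset.mem_filter, Finset.mem_univ, true_and] at hi
    have h1 : (L.1.symm i).1 = stepRow c := by
      cases c
      · have := hi.2
        simp only [decide_eq_false_iff_not] at this
        simp only [stepRow]
        omega
      · simpa [stepRow] using hi.2
    have h2 : L.1 (stepRow c, (L.1.symm i).2) = i := by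
      rw [← h1]; simp
    refine ⟨(L.1.symm i).2, ?_, h2⟩
    simp only [Finset.mem_filter, Finset.mem_univ, true_and, h2]
    exact hi.1

theorem lt_count_take_word_iff (L : PosetLinearExtension (CatalanPoset n)) (c : Bool) (t : ℕ)
    (a : Fin n) : (a : ℕ) < (L.word.take t).count c ↔ (L.1 (stepRow c, a) : ℕ) < t := by
  rw [count_take_word]
  refine lt_card_filter_lt_iff (f := fun a => (L.1 (stepRow c, a) : ℕ)) ?_ t a
  intro a a' h
  exact L.2 (Prod.mk_le_mk.2 ⟨le_rfl, h⟩)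

theorem count_take_word_le (L : PosetLinearExtension (CatalanPoset n)) (c : Bool) (t : ℕ) :
    (L.word.take t).count c ≤ n := by
  rw [count_take_word]
  simpa using Finset.card_le_univ (Finset.univ.filter fun a : Fin n =>
    (L.1 (stepRow c, a) : ℕ) < t)

theorem count_word (L : PosetLinearExtension (CatalanPoset n)) (c : Bool) :
    L.word.count c = n := by
  have h := count_take_word L c (Fintype.card (CatalanPoset n))
  rw [List.take_of_length_le (by simp [word])] at h
  rw [h, Finset.filter_true_of_mem fun a _ => (L.1 (stepRow c, a)).2]
  simp

theorem word_mem_walks (L : PosetLinearExtension (CatalanPoset n)) : L.word ∈ walks (n + n) 0 := by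
  rw [mem_walks, isWalk_iff]
  refine ⟨L.length_word, fun t => ?_, by simp [count_word]⟩
  -- If the downs outnumbered the ups in a prefix with u ups, (1, u) would lie in that prefix and
  -- (0, u) would not, against (0, u) ≤ (1, u).
  by_contra h
  have hlt : (L.word.take t).count true < n := by
    have := L.count_take_word_le false t
    omega
  have h1 := (L.lt_count_take_word_iff false t ⟨_, hlt⟩).1 (by simp only; omega)
  have h2 := (L.lt_count_take_word_iff true t ⟨_, hlt⟩).2 (lt_of_le_of_lt
    (Fin.le_def.1 (L.2 (Prod.mk_le_mk.2 ⟨by decide, le_rfl⟩))) h1)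
  simp at h2

theorem word_injective : Function.Injective (word (n := n)) := by
  intro L L' h
  have key : ∀ c a, L.1 (stepRow c, a) = L'.1 (stepRow c, a) := by
    intro c a
    have h1 : ∀ t, (L.1 (stepRow c, a) : ℕ) < t ↔ (L'.1 (stepRow c, a) : ℕ) < t := fun t => by
      rw [← lt_count_take_word_iff, ← lt_count_take_word_iff, h]
    have h2 := (h1 _).1 (Nat.lt_succ_self _)
    have h3 := (h1 _).2 (Nat.lt_succ_self _)
    exact Fin.ext (by omega)
  refine Subtype.ext (Equiv.ext ?_)
  rintro ⟨c, a⟩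
  fin_cases c
  · exact key true a
  · exact key false a

theorem exists_word_eq {l : List Bool} (hl : l ∈ walks (n + n) 0) :
    ∃ L : PosetLinearExtension (CatalanPoset n), L.word = l := by
  rw [mem_walks, isWalk_iff] at hl
  obtain ⟨hlen, hpre, htot⟩ := hl
  have hcount : ∀ c, l.count c = n := by
    have := List.count_true_add_count_false (l := l)
    intro c
    cases c <;> omega
  have hlt : ∀ i : Fin (Fintype.card (CatalanPoset n)), (i : ℕ) < l.length := fun i => by
    rw [hlen, ← card_catalanPoset]; exact i.2
  have hmono : ∀ c s t, s ≤ t → (l.take s).count c ≤ (l.take t).count c := fun c s t h =>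
    List.Sublist.count_le _ (List.take_sublist_take_left h)
  have hstep : ∀ i : Fin (Fintype.card (CatalanPoset n)),
      (l.take (i + 1)).count (l[i]'(hlt i)) = (l.take i).count (l[i]'(hlt i)) + 1 := fun i => by
    have := count_take_succ l (l[i]'(hlt i)) i (hlt i)
    simpa using this
  have hle : ∀ i : Fin (Fintype.card (CatalanPoset n)),
      (l.take i).count (l[i]'(hlt i)) < n := fun i => by
    have h1 := (List.take_sublist (i + 1) l).count_le (l[i]'(hlt i))
    rw [hstep, hcount] at h1
    exact h1
  -- The inverse enumeration: a letter gives the chain, and the number of earlier equal letters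
  -- gives the position in it.
  let g : Fin (Fintype.card (CatalanPoset n)) → CatalanPoset n := fun i =>
    (stepRow (l[i]'(hlt i)), ⟨(l.take i).count (l[i]'(hlt i)), hle i⟩)
  have hg : ∀ i j, i < j → ¬ g j ≤ g i := by
    intro i j hij hgle
    obtain ⟨h1, h2⟩ := Prod.mk_le_mk.1 hgle
    rw [Fin.mk_le_mk] at h2
    have h3 := hstep i
    have h4 := hmono (l[i]'(hlt i)) (i + 1) j hij
    -- Nonnegativity matters only for a down step at i followed by an up step at j.
    have h5 := hpre (i + 1)
    have h6 := hmono true (i + 1) j hij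
    generalize l[i]'(hlt i) = x at *
    generalize l[j]'(hlt j) = y at *
    cases x <;> cases y
    · omega
    · omega
    · simp [stepRow] at h1
    · omega
  have hinj : Function.Injective g := by
    intro i j h
    rcases lt_trichotomy i j with h' | h' | h'
    · exact (hg i j h' h.ge).elim
    · exact h'
    · exact (hg j i h' h.le).elim
  have hbij : Function.Bijective g :=
    (Fintype.bijective_iff_injective_and_card g).2 ⟨hinj, by simp⟩
  have hL : Monotone (Equiv.ofBijective g hbij).symm := by
    intro x y hxy
    by_contra h
    refine hg _ _ (not_le.1 h) ?_
    have h1 := Equiv.ofBijective_apply_symm_apply g hbij x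
    have h2 := Equiv.ofBijective_apply_symm_apply g hbij y
    rw [h1, h2]
    exact hxy
  refine ⟨⟨(Equiv.ofBijective g hbij).symm, hL⟩, ?_⟩
  refine List.ext_getElem ((length_word _).trans hlen.symm) ?_
  intro i h1 h2
  simp only [word, List.getElem_ofFn, Equiv.symm_symm, Equiv.ofBijective_apply, g]
  simp only [Fin.getElem_fin]
  generalize l[i] = x
  cases x <;> simp [stepRow]

theorem card_subtype_eq (P : PosetLinearExtension (CatalanPoset n) → Prop) (Q : List Bool → Prop)
    [DecidablePred Q] (h : ∀ L, P L ↔ Q L.word) :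
    Nat.card {L // P L} = ((walks (n + n) 0).filter Q).card := by
  rw [← Nat.card_eq_finsetCard]
  refine Nat.card_congr (Equiv.ofBijective
    (fun L => ⟨L.1.word, Finset.mem_filter.2 ⟨L.1.word_mem_walks, (h _).1 L.2⟩⟩) ⟨?_, ?_⟩)
  · intro L L' hL
    exact Subtype.ext (word_injective (Subtype.ext_iff.1 hL))
  · rintro ⟨l, hl⟩
    rw [Finset.mem_filter] at hl
    obtain ⟨L, rfl⟩ := exists_word_eq hl.1
    exact ⟨⟨L, (h L).2 hl.2⟩, rfl⟩

theorem card_eq (n : ℕ) : Nat.card (PosetLinearExtension (CatalanPoset n))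
    = walkCount (n + n) 0 := by
  rw [← card_walks, ← Finset.filter_true_of_mem (s := walks (n + n) 0) (p := fun _ => True)
    (fun _ _ => trivial), ← card_subtype_eq (fun _ => True) _ (fun _ => Iff.rfl)]
  exact Nat.card_congr (Equiv.subtypeUnivEquiv fun _ => trivial).symm

/-- The time a + b + 1 is critical: a prefix of that length contains exactly one of the two
elements. It contains (1, b) iff it has at least b + 1 downs, hence at most a ups, i.e. height at
most a - (b + 1) = k. -/
theorem down_le_up_iff (L : PosetLinearExtension (CatalanPoset n)) (a b : Fin n) (k : ℕ)
    (h : (a : ℕ) = b + 1 + k) :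
    L.1 (1, b) ≤ L.1 (0, a) ↔ ∃ z ≤ k, IsWalk (L.word.take (a + b + 1)) 0 z := by
  have ha := a.2
  have hb := b.2
  have hup := L.lt_count_take_word_iff true (a + b + 1) a
  have hdown := L.lt_count_take_word_iff false (a + b + 1) b
  simp only [stepRow] at hup hdown
  have hlen := List.count_true_add_count_false (l := L.word.take (a + b + 1))
  rw [List.length_take, length_word, min_eq_left (by omega)] at hlen
  have hpre := ((isWalk_iff _ _ _).1 (mem_walks.1 L.word_mem_walks).2).1
  have hwalk : ∀ z, IsWalk (L.word.take (a + b + 1)) 0 z ↔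
      (L.word.take (a + b + 1)).count true = z + (L.word.take (a + b + 1)).count false := by
    intro z
    rw [isWalk_iff, zero_add]
    refine and_iff_right fun t => ?_
    rw [List.take_take]
    exact hpre _
  have hp := hpre (a + b + 1)
  simp only [hwalk, Fin.le_def]
  constructor
  · intro hle
    refine ⟨(L.word.take (a + b + 1)).count true - (L.word.take (a + b + 1)).count false, ?_, ?_⟩
    · by_contra hk
      omega
    · omega
  · rintro ⟨z, hz, hw⟩
    by_contra hlt
    omega

theorem card_down_le_up (a b : Fin n) (k : ℕ) (h : (a : ℕ) = b + 1 + k) (t s : ℕ)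
    (ht : t = a + b + 1) (hs : t + s = n + n) :
    Nat.card {L : PosetLinearExtension (CatalanPoset n) // L.1 (1, b) ≤ L.1 (0, a)}
      = splitCount t s k := by
  classical
  rw [card_subtype_eq _ (fun l => ∃ z ≤ k, IsWalk (l.take (a + b + 1)) 0 z)
    fun L => down_le_up_iff L a b k h, ← hs, ← ht, card_walks_below]

end PosetLinearExtension

/-! ### The height at the middle time: location of the median and local bounds. -/

/-- The probability that a uniformly random nonnegative closed walk of length `2 n` at height `0`
is at height `k` after `n` steps. -/
noncomputable def midProb (n k : ℕ) : ℝ := (walkCount n k : ℝ) ^ 2 / walkCount (n + n) 0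

theorem walkCount_closed_pos (n : ℕ) : (0 : ℝ) < walkCount (n + n) 0 := by
  exact_mod_cast walkCount_pos (Nat.zero_le _) (by omega)

theorem midProb_nonneg (n k : ℕ) : 0 ≤ midProb n k := by
  unfold midProb; positivity

theorem midProb_eq_zero_of_odd {n k : ℕ} (h : (n + k) % 2 = 1) : midProb n k = 0 := by
  simp [midProb, walkCount_eq_zero_of_odd h]

theorem sum_range_midProb (n k : ℕ) :
    ∑ i ∈ Finset.range (k + 1), midProb n i = splitCount n n k / walkCount (n + n) 0 := by
  simp only [midProb, splitCount, Nat.cast_sum, Nat.cast_mul, Finset.sum_div, sq]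

theorem sum_range_midProb_eq_one {n m : ℕ} (h : n < m) :
    ∑ i ∈ Finset.range m, midProb n i = 1 := by
  obtain ⟨k, rfl⟩ : ∃ k, m = k + 1 := ⟨m - 1, by omega⟩
  rw [sum_range_midProb, splitCount_eq_of_left_le (by omega), div_self (walkCount_closed_pos n).ne']

theorem sum_midProb_le_one (n : ℕ) (s : Finset ℕ) : ∑ i ∈ s, midProb n i ≤ 1 := by
  rw [← sum_range_midProb_eq_one (n := n) (m := n + 1 + s.sup id + 1) (by omega)]
  refine Finset.sum_le_sum_of_subset_of_nonneg (fun i hi => ?_) fun i _ _ => midProb_nonneg n i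
  have : id i ≤ s.sup id := Finset.le_sup hi
  simp only [id] at this
  simp only [Finset.mem_range]
  omega

theorem midProb_add_two_le {n i : ℕ} {c : ℝ}
    (h : walkCount n (i + 2) ≤ c * walkCount n i) : midProb n (i + 2) ≤ c ^ 2 * midProb n i := by
  unfold midProb
  rw [← mul_div_assoc, ← mul_pow]
  gcongr

theorem le_midProb_add_two {n i : ℕ} {c : ℝ} (hc : 0 ≤ c)
    (h : c * walkCount n i ≤ walkCount n (i + 2)) : c ^ 2 * midProb n i ≤ midProb n (i + 2) := by
  unfold midProb
  rw [← mul_div_assoc, ← mul_pow]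
  gcongr

theorem midProb_le_add_two {n i : ℕ} (h : (i + 2) ^ 2 ≤ n) : midProb n i ≤ midProb n (i + 2) := by
  rw [← one_mul (midProb n i), ← one_pow 2]
  refine le_midProb_add_two zero_le_one ?_
  have h' : ((i : ℝ) + 2) ^ 2 ≤ n := by exact_mod_cast h
  have hpos : (0 : ℝ) < ((i : ℝ) + 1) * (n + i + 4) := by positivity
  rw [one_mul]
  refine le_of_mul_le_mul_left ?_ hpos
  rw [walkCount_add_two_mul]
  refine mul_le_mul_of_nonneg_right ?_ (Nat.cast_nonneg _)
  nlinarith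

theorem midProb_le_add_two_mul {n i m : ℕ} (h : (i + 2 * m) ^ 2 ≤ n) :
    midProb n i ≤ midProb n (i + 2 * m) := by
  induction m with
  | zero => simp
  | succ m ih =>
    refine (ih (le_trans (by gcongr; omega) h)).trans ?_
    exact midProb_le_add_two h

/-- The median is at least of order √n. Otherwise `midProb` increases along each parity class up to
5w, so the blocks starting at 2w and 4w (even shifts) weigh at least as much as the first, and the
total exceeds 1. -/
theorem lt_sq_of_half_le_sum {n w : ℕ} (h : 1 / 2 ≤ ∑ i ∈ Finset.range w, midProb n i) :
    n < (5 * w) ^ 2 := by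
  by_contra hn
  have h1 : ∑ i ∈ Finset.range w, midProb n i ≤ ∑ i ∈ Finset.range w, midProb n (2 * w + i) := by
    refine Finset.sum_le_sum fun i hi => ?_
    rw [add_comm]
    refine midProb_le_add_two_mul (le_trans ?_ (not_lt.1 hn))
    rw [Finset.mem_range] at hi
    gcongr; omega
  have h2 : ∑ i ∈ Finset.range w, midProb n i ≤ ∑ i ∈ Finset.range w, midProb n (4 * w + i) := by
    refine Finset.sum_le_sum fun i hi => ?_
    rw [add_comm, show 4 * w = 2 * (2 * w) by ring]
    refine midProb_le_add_two_mul (le_trans ?_ (not_lt.1 hn))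
    rw [Finset.mem_range] at hi
    gcongr; omega
  have h3 := sum_midProb_le_one n (Finset.range (w + w + w + w + w))
  simp only [Finset.sum_range_add] at h3
  have e1 : w + w = 2 * w := by ring
  have e2 : w + w + w + w = 4 * w := by ring
  rw [e2, e1] at h3
  have p1 : 0 ≤ ∑ i ∈ Finset.range w, midProb n (w + i) :=
    Finset.sum_nonneg fun _ _ => midProb_nonneg _ _
  have p2 : 0 ≤ ∑ i ∈ Finset.range w, midProb n (2 * w + w + i) :=
    Finset.sum_nonneg fun _ _ => midProb_nonneg _ _
  linarith

theorem one_sub_pow_le_half {δ : ℝ} {m : ℕ} (h0 : 0 ≤ δ) (h1 : δ ≤ 1) (h : 1 ≤ m * δ) :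
    (1 - δ) ^ m ≤ 1 / 2 := by
  have hb := one_add_mul_le_pow (a := δ) (by linarith) m
  have hp : (1 - δ) ^ m * (1 + δ) ^ m ≤ 1 := by
    rw [← mul_pow]
    exact pow_le_one₀ (by nlinarith) (by nlinarith)
  have hn : 0 ≤ (1 - δ) ^ m := pow_nonneg (by linarith) m
  nlinarith

section

variable {n : ℕ} {r : ℝ}

theorem midProb_add_two_le_of_large (hr : r ^ 2 = n) (hr4 : 4 ≤ r) {i : ℕ} (hi : 2 * r ≤ i) :
    midProb n (i + 2) ≤ (1 - 1 / r) * midProb n i := by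
  have hr0 : 0 < r := by linarith
  have hδ : 1 / r ≤ 1 := by rw [div_le_one hr0]; linarith
  have hδ0 : 0 < 1 / r := by positivity
  refine (midProb_add_two_le (c := 1 - 1 / r) ?_).trans ?_
  · rcases le_or_gt i n with hin | hin
    · have hin' : (i : ℝ) ≤ n := by exact_mod_cast hin
      have hpos : (0 : ℝ) < ((i : ℝ) + 1) * (n + i + 4) := by positivity
      refine le_of_mul_le_mul_left ?_ hpos
      rw [walkCount_add_two_mul, ← mul_assoc]
      refine mul_le_mul_of_nonneg_right ?_ (Nat.cast_nonneg _)
      have h1 : ((i : ℝ) + 1) * (n + i + 4) * (1 / r) ≤ 3 * r * (i + 1) := by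
        rw [mul_one_div, div_le_iff₀ hr0]
        have : (n : ℝ) + i + 4 ≤ 3 * r ^ 2 := by nlinarith
        nlinarith
      nlinarith
    · rw [walkCount_eq_zero_of_lt hin, walkCount_eq_zero_of_lt (show n < i + 2 by omega)]
      simp
  · refine mul_le_mul_of_nonneg_right ?_ (midProb_nonneg n i)
    nlinarith

theorem midProb_add_two_mul_le_of_large (hr : r ^ 2 = n) (hr4 : 4 ≤ r) {i : ℕ} (hi : 2 * r ≤ i)
    (m : ℕ) : midProb n (i + 2 * m) ≤ (1 - 1 / r) ^ m * midProb n i := by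
  have hr0 : 0 < r := by linarith
  have hδ : 1 / r ≤ 1 := by rw [div_le_one hr0]; linarith
  induction m with
  | zero => simp
  | succ m ih =>
    refine (midProb_add_two_le_of_large hr hr4 (i := i + 2 * m) (by push_cast; linarith)).trans ?_
    rw [pow_succ', mul_assoc]
    exact mul_le_mul_of_nonneg_left ih (by linarith)

/-- The median is at most of order √n: beyond 2r the weights decay geometrically, and a shift by
2⌈r⌉ halves them, so the tail from about 4r has mass at most 1/2. -/
theorem le_of_sum_lt_half (hr : r ^ 2 = n) (hr4 : 4 ≤ r) {w : ℕ}
    (h : ∑ i ∈ Finset.range w, midProb n i < 1 / 2) : w ≤ 5 * r := by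
  have hr0 : 0 < r := by linarith
  have hδ : 1 / r ≤ 1 := by rw [div_le_one hr0]; linarith
  by_contra hw
  have hm : r ≤ ⌈r⌉₊ := Nat.le_ceil r
  have hm' : (⌈r⌉₊ : ℝ) < r + 1 := Nat.ceil_lt_add_one hr0.le
  have hx : 2 * r ≤ ⌈2 * r⌉₊ := Nat.le_ceil _
  have hx' : (⌈2 * r⌉₊ : ℝ) < 2 * r + 1 := Nat.ceil_lt_add_one (by linarith)
  set m := ⌈r⌉₊
  set x := ⌈2 * r⌉₊
  have hle : x + 2 * m ≤ w := by
    have : ((x + 2 * m : ℕ) : ℝ) < w + 1 := by push_cast; linarith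
    exact Nat.lt_succ_iff.1 (by exact_mod_cast this)
  have h1 : ∑ i ∈ Finset.range (x + 2 * m), midProb n i < 1 / 2 :=
    (Finset.sum_le_sum_of_subset_of_nonneg (Finset.range_mono hle)
      fun i _ _ => midProb_nonneg n i).trans_lt h
  have h2 := sum_range_midProb_eq_one (n := n) (m := x + 2 * m + (n + 1)) (by omega)
  rw [Finset.sum_range_add] at h2
  have h3 : ∑ i ∈ Finset.range (n + 1), midProb n (x + 2 * m + i)
      ≤ ∑ i ∈ Finset.range (n + 1), 1 / 2 * midProb n (x + i) := by
    refine Finset.sum_le_sum fun i _ => ?_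
    rw [add_right_comm]
    refine (midProb_add_two_mul_le_of_large hr hr4 (by push_cast; linarith [i.cast_nonneg (α := ℝ)])
      m).trans ?_
    refine mul_le_mul_of_nonneg_right (one_sub_pow_le_half (by positivity) hδ ?_)
      (midProb_nonneg _ _)
    rw [mul_one_div, le_div_iff₀ hr0]
    linarith
  rw [← Finset.mul_sum] at h3
  have h4 := sum_midProb_le_one n (Finset.range (x + (n + 1)))
  rw [Finset.sum_range_add] at h4
  have h5 : 0 ≤ ∑ i ∈ Finset.range x, midProb n i :=
    Finset.sum_nonneg fun _ _ => midProb_nonneg _ _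
  linarith

theorem le_midProb_add_two_of_small (hr : r ^ 2 = n) (hr32 : 32 ≤ r) {i : ℕ} (hi : i ≤ 6 * r) :
    (1 - 32 / r) * midProb n i ≤ midProb n (i + 2) := by
  have hr0 : 0 < r := by linarith
  have hδ : 16 / r ≤ 1 / 2 := by rw [div_le_div_iff₀ hr0 two_pos]; linarith
  refine le_trans ?_ (le_midProb_add_two (c := 1 - 16 / r) (by linarith) ?_)
  · refine mul_le_mul_of_nonneg_right ?_ (midProb_nonneg n i)
    have : 32 / r = 2 * (16 / r) := by ring
    nlinarith [sq_nonneg (16 / r)]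
  · have hpos : (0 : ℝ) < ((i : ℝ) + 1) * (n + i + 4) := by positivity
    refine le_of_mul_le_mul_left ?_ hpos
    rw [walkCount_add_two_mul, ← mul_assoc]
    refine mul_le_mul_of_nonneg_right ?_ (Nat.cast_nonneg _)
    have h1 : (2 * i + 4 : ℝ) ≤ (n + i + 4) * (16 / r) := by
      rw [← mul_div_assoc, le_div_iff₀ hr0]
      nlinarith [i.cast_nonneg (α := ℝ)]
    have h2 : ((n : ℝ) + i + 4) * (1 - 16 / r) ≤ n - i := by linarith
    have h3 : (0 : ℝ) ≤ n - i := by nlinarith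
    calc ((i : ℝ) + 1) * (n + i + 4) * (1 - 16 / r)
        = (i + 1) * ((n + i + 4) * (1 - 16 / r)) := by ring
      _ ≤ (i + 1) * (n - i) := by gcongr
      _ ≤ (i + 3) * (n - i) := by gcongr; norm_num

theorem le_midProb_add_two_mul_of_small (hr : r ^ 2 = n) (hr32 : 32 ≤ r) {i m : ℕ}
    (hi : i + 2 * m ≤ 6 * r) : (1 - 32 / r) ^ m * midProb n i ≤ midProb n (i + 2 * m) := by
  have hr0 : 0 < r := by linarith
  have hδ : 32 / r ≤ 1 := by rw [div_le_one hr0]; linarith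
  induction m with
  | zero => simp
  | succ m ih =>
    push_cast at hi
    refine le_trans ?_ (le_midProb_add_two_of_small hr hr32 (i := i + 2 * m)
      (by push_cast; linarith))
    rw [pow_succ', mul_assoc]
    exact mul_le_mul_of_nonneg_left (ih (by linarith)) (by linarith)

/-- Each of the ⌈r / 64⌉ heights k, k + 2, … carries at least half the mass of k, and the total is
at most 1. -/
theorem midProb_le (hr : r ^ 2 = n) (hr32 : 32 ≤ r) {k : ℕ} (hk : k ≤ 5 * r) :
    midProb n k ≤ 128 / r := by
  have hr0 : 0 < r := by linarith
  have hδ : 32 / r ≤ 1 := by rw [div_le_one hr0]; linarith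
  have hm : r / 64 ≤ ⌈r / 64⌉₊ := Nat.le_ceil _
  have hm' : (⌈r / 64⌉₊ : ℝ) < r / 64 + 1 := Nat.ceil_lt_add_one (by positivity)
  set m := ⌈r / 64⌉₊
  have h1 : ∑ i ∈ Finset.range m, midProb n (k + 2 * i) ≤ 1 := by
    have h := sum_midProb_le_one n ((Finset.range m).image fun i => k + 2 * i)
    rwa [Finset.sum_image (fun i _ j _ hij => by simpa using hij)] at h
  have h2 : ∑ _i ∈ Finset.range m, 1 / 2 * midProb n k
      ≤ ∑ i ∈ Finset.range m, midProb n (k + 2 * i) := by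
    refine Finset.sum_le_sum fun i hi => ?_
    have him : (i : ℝ) + 1 ≤ m := by exact_mod_cast Finset.mem_range.1 hi
    refine le_trans ?_ (le_midProb_add_two_mul_of_small hr hr32 (by linarith))
    refine mul_le_mul_of_nonneg_right ?_ (midProb_nonneg _ _)
    have hb := one_add_mul_le_pow (a := -(32 / r)) (by linarith) i
    have : i * (32 / r) ≤ 1 / 2 := by
      rw [← mul_div_assoc, div_le_div_iff₀ hr0 two_pos]
      linarith
    rw [← sub_eq_add_neg] at hb
    linarith
  rw [Finset.sum_const, Finset.card_range, nsmul_eq_mul] at h2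
  rw [le_div_iff₀ hr0]
  have h3 := mul_le_mul_of_nonneg_right hm (midProb_nonneg n k)
  linarith

theorem exp_neg_two_mul_le_one_sub {x : ℝ} (h0 : 0 ≤ x) (h : x ≤ 1 / 2) :
    Real.exp (-(2 * x)) ≤ 1 - x := by
  rw [Real.exp_neg, inv_le_comm₀ (Real.exp_pos _) (by linarith)]
  refine le_trans ?_ (Real.add_one_le_exp _)
  rw [inv_le_iff_one_le_mul₀ (by linarith)]
  nlinarith

/-- Climbing to k from below takes at most 5r/2 double steps, each costing a factor at least
exp(-64/r), altogether exp(-160). The k + 1 ≤ 6r heights up to k share mass at least 1/2. -/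
theorem le_midProb_of_half_le_sum (hr : r ^ 2 = n) (hr64 : 64 ≤ r) {k : ℕ} (hk : k ≤ 5 * r)
    (hpar : (n + k) % 2 = 0) (h : 1 / 2 ≤ ∑ i ∈ Finset.range (k + 1), midProb n i) :
    Real.exp (-160) / (12 * r) ≤ midProb n k := by
  have hr0 : 0 < r := by linarith
  have hδ : 32 / r ≤ 1 / 2 := by rw [div_le_div_iff₀ hr0 two_pos]; linarith
  have h1 : ∀ i ∈ Finset.range (k + 1), midProb n i ≤ midProb n k / Real.exp (-160) := by
    intro i hi
    rw [le_div_iff₀ (Real.exp_pos _)]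
    rw [Finset.mem_range] at hi
    by_cases hp : (n + i) % 2 = 0
    · obtain ⟨m, rfl⟩ : ∃ m, k = i + 2 * m := ⟨(k - i) / 2, by omega⟩
      push_cast at hk
      refine le_trans ?_ (le_midProb_add_two_mul_of_small hr (by linarith) (by linarith))
      rw [mul_comm]
      refine mul_le_mul_of_nonneg_right ?_ (midProb_nonneg _ _)
      refine le_trans ?_ (pow_le_pow_left₀ (Real.exp_pos _).le
        (exp_neg_two_mul_le_one_sub (by positivity) hδ) m)
      rw [← Real.exp_nat_mul, Real.exp_le_exp]
      have : m * (2 * (32 / r)) ≤ 160 := by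
        rw [show (m : ℝ) * (2 * (32 / r)) = 64 * m / r by ring, div_le_iff₀ hr0]
        linarith [i.cast_nonneg (α := ℝ)]
      linarith
    · rw [midProb_eq_zero_of_odd (by omega), zero_mul]
      exact midProb_nonneg _ _
  have h2 := Finset.sum_le_card_nsmul _ _ _ h1
  rw [Finset.card_range, nsmul_eq_mul, ← mul_div_assoc] at h2
  have h3 := h.trans h2
  rw [div_le_div_iff₀ two_pos (Real.exp_pos _)] at h3
  rw [div_le_iff₀ (by positivity)]
  push_cast at h3
  have h4 : midProb n k * (k + 1) ≤ midProb n k * (6 * r) :=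
    mul_le_mul_of_nonneg_left (by linarith) (midProb_nonneg _ _)
  linarith

theorem midProb_add_two_le_nine_mul (n k : ℕ) : midProb n (k + 2) ≤ 9 * midProb n k := by
  have h : (9 : ℝ) = 3 ^ 2 := by norm_num
  rw [h]
  refine midProb_add_two_le ?_
  have hpos : (0 : ℝ) < ((k : ℝ) + 1) * (n + k + 4) := by positivity
  refine le_of_mul_le_mul_left ?_ hpos
  rw [walkCount_add_two_mul, ← mul_assoc]
  refine mul_le_mul_of_nonneg_right ?_ (Nat.cast_nonneg _)
  have h0 := k.cast_nonneg (α := ℝ)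
  have h1 := n.cast_nonneg (α := ℝ)
  nlinarith [mul_nonneg h0 h1]

/-- A height just below the median of the height of the middle point of a random closed walk. -/
theorem exists_near_median (hr : r ^ 2 = n) (hr64 : 64 ≤ r) :
    ∃ k : ℕ, (n + k) % 2 = 0 ∧ r / 10 ≤ k + 1 ∧ k ≤ 5 * r ∧
      ∑ i ∈ Finset.range (k + 1), midProb n i < 1 / 2 ∧
      1 / 2 - 128 / r ≤ ∑ i ∈ Finset.range (k + 1), midProb n i ∧
      Real.exp (-160) / (108 * r) ≤ midProb n k := by
  have hr0 : 0 < r := by linarith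
  have hex : ∃ w, 1 / 2 ≤ ∑ i ∈ Finset.range (w + 1), midProb n i :=
    ⟨n, by rw [sum_range_midProb_eq_one (by omega)]; norm_num⟩
  classical
  obtain ⟨w, hw, hmin⟩ : ∃ w, 1 / 2 ≤ ∑ i ∈ Finset.range (w + 1), midProb n i ∧
      ∀ v < w, ∑ i ∈ Finset.range (v + 1), midProb n i < 1 / 2 :=
    ⟨Nat.find hex, Nat.find_spec hex, fun v hv => not_le.1 (Nat.find_min hex hv)⟩
  have hlow : r < 5 * (w + 1) := by
    have h : (n : ℝ) < (5 * ((w : ℝ) + 1)) ^ 2 := by exact_mod_cast lt_sq_of_half_le_sum hw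
    rw [← hr] at h
    exact lt_of_pow_lt_pow_left₀ 2 (by positivity) h
  -- Here w is the median, and k is the preceding height of the same parity. The sum up to k misses
  -- 1/2 by at most the mass at w; descending from w to k costs the factor 9 in 108 = 9 · 12.
  obtain ⟨k, rfl⟩ : ∃ k, w = k + 2 := by
    have : 2 ≤ w := by
      by_contra h
      have : (w : ℝ) ≤ 1 := by exact_mod_cast (by omega : w ≤ 1)
      linarith
    exact ⟨w - 2, by omega⟩
  have hlt := hmin (k + 1) (by omega)
  have hpar : (n + (k + 2)) % 2 = 0 := by
    by_contra h
    rw [Finset.sum_range_succ, midProb_eq_zero_of_odd (k := k + 2) (by omega), add_zero] at hw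
    exact absurd hw (not_le.2 hlt)
  have hup := le_of_sum_lt_half hr (by linarith) hlt
  push_cast at hup hlow
  have hup' : ((k + 2 : ℕ) : ℝ) ≤ 5 * r := by push_cast; linarith
  refine ⟨k, by omega, by linarith, by linarith, hmin k (by omega), ?_, ?_⟩
  · rw [Finset.sum_range_succ, Finset.sum_range_succ _ (k + 1),
      midProb_eq_zero_of_odd (k := k + 1) (by omega), add_zero] at hw
    have := midProb_le hr (by linarith) hup'
    linarith
  · have h1 := le_midProb_of_half_le_sum hr hr64 hup' hpar hw
    have h2 := midProb_add_two_le_nine_mul n k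
    have h3 : Real.exp (-160) / (12 * r) = 9 * (Real.exp (-160) / (108 * r)) := by
      field_simp; norm_num
    linarith

end

/-! ### Moving the cut time. -/

/-- Both boundary terms are explicit multiples of `walkCount t k * walkCount s k`. They cancel when
t = s, which leaves the small factor t - s. -/
theorem splitCount_sub_mul (t s k : ℕ) (ht : (t + k) % 2 = 0) :
    ((k : ℝ) + 1) * (t + k + 4) * (s + k + 4) *
        ((splitCount (t + 2) s k : ℝ) - splitCount t (s + 2) k)
      = 2 * (k + 2) * (k + 3) * (t - s) * (walkCount t k * walkCount s k) := by
  have h : (splitCount (t + 2) s k : ℝ) + walkCount t k * walkCount (s + 1) (k + 1)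
      = splitCount t (s + 2) k + walkCount (t + 1) (k + 1) * walkCount s k := by
    exact_mod_cast splitCount_add_two t s k ht
  have h1 := walkCount_succ_succ_mul t k
  have h2 := walkCount_succ_succ_mul s k
  linear_combination ((k : ℝ) + 1) * (t + k + 4) * (s + k + 4) * h
    + (s + k + 4) * walkCount s k * h1 - (t + k + 4) * walkCount t k * h2

section

variable {n : ℕ} {r : ℝ}

/-- Two more steps multiply the count by 4 up to a relative error O(1/n), because k² = O(n). -/
theorem walkCount_add_two_left_bounds (hr : r ^ 2 = n) (hr64 : 64 ≤ r) {k t : ℕ} (hk : k ≤ 5 * r)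
    (ht : (n : ℝ) / 2 ≤ t) :
    (1 - 300 / (n : ℝ)) * (4 * walkCount t k) ≤ walkCount (t + 2) k ∧
      (walkCount (t + 2) k : ℝ) ≤ (1 + 300 / (n : ℝ)) * (4 * walkCount t k) := by
  have hn : (4096 : ℝ) ≤ n := by rw [← hr]; nlinarith
  have hn0 : (0 : ℝ) < n := by linarith
  have hk0 := k.cast_nonneg (α := ℝ)
  have hkn : ((k : ℝ) + 1) ^ 2 ≤ 36 * n := by rw [← hr]; nlinarith
  have hε0 : 0 < 300 / (n : ℝ) := by positivity
  have hA : 12 / 100 * (n : ℝ) ^ 2 ≤ (t + 2 - k) * (t + k + 4) := by nlinarith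
  have hA0 : (0 : ℝ) < (t + 2 - k) * (t + k + 4) := lt_of_lt_of_le (by positivity) hA
  have hε : 36 * n ≤ 300 / (n : ℝ) * ((t + 2 - k) * (t + k + 4)) := by
    rw [div_mul_eq_mul_div, le_div_iff₀ hn0]
    linarith
  have hε' : 150 ≤ 300 / (n : ℝ) * (t + 3) := by
    rw [div_mul_eq_mul_div, le_div_iff₀ hn0]
    linarith
  have hid := walkCount_add_two_left_mul t k
  have hM := (walkCount t k).cast_nonneg (α := ℝ)
  constructor
  · refine le_of_mul_le_mul_left ?_ hA0
    rw [hid]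
    have hlow : (1 - 300 / (n : ℝ)) * ((t + 2 - k) * (t + k + 4)) ≤ (t + 1) * (t + 2) := by
      nlinarith
    nlinarith
  · refine le_of_mul_le_mul_left ?_ hA0
    rw [hid]
    have hup : ((t : ℝ) + 1) * (t + 2) ≤ (1 + 300 / (n : ℝ)) * ((t + 2 - k) * (t + k + 4)) := by
      nlinarith
    nlinarith

theorem walkCount_add_two_mul_left_bounds (hr : r ^ 2 = n) (hr64 : 64 ≤ r) {k t m : ℕ}
    (hk : k ≤ 5 * r) (ht : (n : ℝ) / 2 ≤ t) (hm : 600 * m ≤ n) :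
    1 / 2 * (4 ^ m * walkCount t k) ≤ (walkCount (t + 2 * m) k : ℝ) ∧
      (walkCount (t + 2 * m) k : ℝ) ≤ 2 * (4 ^ m * walkCount t k) := by
  have hn : (4096 : ℝ) ≤ n := by rw [← hr]; nlinarith
  have hn0 : (0 : ℝ) < n := by linarith
  have hε0 : 0 < 300 / (n : ℝ) := by positivity
  have hε1 : 300 / (n : ℝ) ≤ 1 := by rw [div_le_one hn0]; linarith
  have hmε : m * (300 / (n : ℝ)) ≤ 1 / 2 := by
    rw [← mul_div_assoc, div_le_div_iff₀ hn0 two_pos]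
    have : (600 : ℝ) * m ≤ n := by exact_mod_cast hm
    linarith
  have hiter : (1 - 300 / (n : ℝ)) ^ m * (4 ^ m * walkCount t k) ≤ (walkCount (t + 2 * m) k : ℝ) ∧
      (walkCount (t + 2 * m) k : ℝ) ≤ (1 + 300 / (n : ℝ)) ^ m * (4 ^ m * walkCount t k) := by
    clear hm hmε
    induction m with
    | zero => simp
    | succ m ih =>
      have h := walkCount_add_two_left_bounds hr hr64 (k := k) (t := t + 2 * m) hk
        (by push_cast; linarith [m.cast_nonneg (α := ℝ)])
      rw [show t + 2 * (m + 1) = t + 2 * m + 2 by ring]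
      constructor
      · refine le_trans ?_ h.1
        have := mul_le_mul_of_nonneg_left ih.1 (show 0 ≤ 4 * (1 - 300 / (n : ℝ)) by linarith)
        rw [pow_succ, pow_succ]
        linarith
      · refine h.2.trans ?_
        have := mul_le_mul_of_nonneg_left ih.2 (show 0 ≤ 4 * (1 + 300 / (n : ℝ)) by linarith)
        rw [pow_succ, pow_succ]
        linarith
  have hlow : 1 / 2 ≤ (1 - 300 / (n : ℝ)) ^ m := by
    have hb := one_add_mul_le_pow (a := -(300 / (n : ℝ))) (by linarith) m
    rw [← sub_eq_add_neg] at hb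
    linarith
  have hup : (1 + 300 / (n : ℝ)) ^ m ≤ 2 := by
    have hp : (1 - 300 / (n : ℝ)) ^ m * (1 + 300 / (n : ℝ)) ^ m ≤ 1 := by
      rw [← mul_pow]
      exact pow_le_one₀ (by nlinarith) (by nlinarith)
    have : 0 ≤ (1 + 300 / (n : ℝ)) ^ m := by positivity
    nlinarith
  exact ⟨le_trans (by gcongr) hiter.1, hiter.2.trans (by gcongr)⟩

/-- The powers of 4 for lengthening one piece and shortening the other cancel up to a single 4; with
two errors of a factor 2 the quotient by `midProb n k` lies between 1/16 and 1. -/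
theorem walkCount_mul_walkCount_bounds (hr : r ^ 2 = n) (hr64 : 64 ≤ r) {k j : ℕ} (hk : k ≤ 5 * r)
    (hj : 600 * (j + 1) ≤ n) :
    midProb n k / 16 ≤ (walkCount (n + 2 * j) k * walkCount (n - 2 * (j + 1)) k : ℝ)
        / walkCount (n + n) 0 ∧
      (walkCount (n + 2 * j) k * walkCount (n - 2 * (j + 1)) k : ℝ) / walkCount (n + n) 0
        ≤ midProb n k := by
  have he := walkCount_closed_pos n
  obtain ⟨s, hs⟩ : ∃ s, n = s + 2 * (j + 1) := ⟨n - 2 * (j + 1), by omega⟩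
  have hs' : n - 2 * (j + 1) = s := by omega
  have h1 := walkCount_add_two_mul_left_bounds hr hr64 (k := k) (t := n) (m := j) hk
    (by linarith [n.cast_nonneg (α := ℝ)]) (by omega)
  have hsn : (n : ℝ) / 2 ≤ s := by
    have : (n : ℝ) ≤ 2 * s := by exact_mod_cast (by omega : n ≤ 2 * s)
    linarith
  have h2 := walkCount_add_two_mul_left_bounds hr hr64 (k := k) (t := s) (m := j + 1) hk hsn hj
  rw [← hs, pow_succ] at h2
  rw [hs']
  unfold midProb
  have hx := (walkCount n k).cast_nonneg (α := ℝ)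
  have hy := (walkCount s k).cast_nonneg (α := ℝ)
  have h4 : (0 : ℝ) < 4 ^ j := by positivity
  set x : ℝ := ((walkCount n k : ℕ) : ℝ)
  set y : ℝ := ((walkCount s k : ℕ) : ℝ)
  set v : ℝ := ((walkCount (n + 2 * j) k : ℕ) : ℝ)
  set c : ℝ := 4 ^ j
  constructor
  · rw [div_right_comm]
    refine div_le_div_of_nonneg_right ?_ he.le
    have e1 := mul_le_mul_of_nonneg_right h1.1 hy
    have e2 := mul_le_mul_of_nonneg_left h2.2 hx
    nlinarith
  · refine div_le_div_of_nonneg_right ?_ he.le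
    have e1 := mul_le_mul_of_nonneg_right h1.2 hy
    have e2 := mul_le_mul_of_nonneg_left h2.1 hx
    nlinarith

/-- The probability that a uniformly random nonnegative closed walk of length `2 n` at height `0`
is at height at most `k` after `n + 2 j` steps. -/
noncomputable def cumProb (n k j : ℕ) : ℝ :=
  splitCount (n + 2 * j) (n - 2 * j) k / walkCount (n + n) 0

theorem cumProb_sub {k j : ℕ} (hpar : (n + k) % 2 = 0) (hj : 2 * (j + 1) ≤ n) :
    cumProb n k (j + 1) - cumProb n k j =
      (walkCount (n + 2 * j) k * walkCount (n - 2 * (j + 1)) k : ℝ) / walkCount (n + n) 0 *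
      (((k : ℝ) + 2) * (k + 3) / (k + 1)) * (4 * (2 * j + 1)) /
      ((n + 2 * j + k + 4) * (n - 2 * j + k + 2)) := by
  have he := walkCount_closed_pos n
  obtain ⟨s, hs⟩ : ∃ s, n = s + 2 * (j + 1) := ⟨n - 2 * (j + 1), by omega⟩
  have hs' : n - 2 * (j + 1) = s := by omega
  have hs2 : n - 2 * j = s + 2 := by omega
  have hsr : (n : ℝ) = s + 2 * (j + 1) := by exact_mod_cast hs
  have h := splitCount_sub_mul (n + 2 * j) s k (by omega)
  unfold cumProb
  rw [hs', hs2, show n + 2 * (j + 1) = n + 2 * j + 2 by ring]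
  push_cast at h
  have hF : (n : ℝ) - 2 * j + k + 2 = s + k + 4 := by rw [hsr]; ring
  have hts : (n : ℝ) + 2 * j - s = 2 * (2 * j + 1) := by rw [hsr]; ring
  rw [hts] at h
  rw [hF]
  field_simp
  linear_combination h

theorem cumProb_sub_bounds (hr : r ^ 2 = n) (hr64 : 64 ≤ r) {k j : ℕ} (hpar : (n + k) % 2 = 0)
    (hk : k ≤ 5 * r) (hk' : r / 10 ≤ k + 1) (hlow : Real.exp (-160) / (108 * r) ≤ midProb n k)
    (hj : 600 * (j + 1) ≤ n) :
    Real.exp (-160) / 34560 * ((2 * j + 1) / (n : ℝ) ^ 2) ≤ cumProb n k (j + 1) - cumProb n k j ∧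
      cumProb n k (j + 1) - cumProb n k j ≤ 36864 * ((2 * j + 1) / (n : ℝ) ^ 2) := by
  have hr0 : 0 < r := by linarith
  have hn : (4096 : ℝ) ≤ n := by rw [← hr]; nlinarith
  have hn0 : (0 : ℝ) < n := by linarith
  have hk0 := k.cast_nonneg (α := ℝ)
  have hj0 := j.cast_nonneg (α := ℝ)
  have hjn : 600 * ((j : ℝ) + 1) ≤ n := by exact_mod_cast hj
  have hrn : 64 * r ≤ n := by rw [← hr]; nlinarith
  rw [cumProb_sub hpar (by omega)]
  obtain ⟨h1, h2⟩ := walkCount_mul_walkCount_bounds hr hr64 hk hj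
  have hup := midProb_le hr (by linarith) hk
  set X : ℝ := (walkCount (n + 2 * j) k * walkCount (n - 2 * (j + 1)) k : ℝ) / walkCount (n + n) 0
  -- This factor of order r compensates the 1/r in `midProb`, so that the increment has order j/n².
  have hc1 : ((k : ℝ) + 2) * (k + 3) / (k + 1) ≤ 36 * r := by
    rw [div_le_iff₀ (by positivity)]
    nlinarith
  have hc2 : r / 10 ≤ ((k : ℝ) + 2) * (k + 3) / (k + 1) := by
    rw [le_div_iff₀ (by positivity)]
    nlinarith
  have hX0 : Real.exp (-160) / (108 * r) / 16 ≤ X := le_trans (by gcongr) h1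
  have hX1 : X ≤ 128 / r := h2.trans hup
  set Y : ℝ := ((k : ℝ) + 2) * (k + 3) / (k + 1)
  have hX : 0 ≤ X := le_trans (by positivity) hX0
  have hY : 0 ≤ Y := le_trans (by positivity) hc2
  have hE1 : (n : ℝ) ≤ n + 2 * j + k + 4 := by linarith
  have hE2 : (n : ℝ) + 2 * j + k + 4 ≤ 4 * n := by linarith
  have hF1 : (n : ℝ) / 2 ≤ n - 2 * j + k + 2 := by linarith
  have hF2 : (n : ℝ) - 2 * j + k + 2 ≤ 2 * n := by linarith
  have hF0 : (0 : ℝ) < n - 2 * j + k + 2 := by linarith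
  constructor
  · calc Real.exp (-160) / 34560 * ((2 * j + 1) / (n : ℝ) ^ 2)
        = Real.exp (-160) / (108 * r) / 16 * (r / 10) * (4 * (2 * j + 1)) / (4 * n * (2 * n)) := by
          field_simp; norm_num
      _ ≤ X * Y * (4 * (2 * j + 1)) / ((n + 2 * j + k + 4) * (n - 2 * j + k + 2)) := by gcongr
  · calc X * Y * (4 * (2 * j + 1)) / ((n + 2 * j + k + 4) * (n - 2 * j + k + 2))
        ≤ 128 / r * (36 * r) * (4 * (2 * j + 1)) / (n * (n / 2)) := by gcongr
      _ = 36864 * ((2 * j + 1) / (n : ℝ) ^ 2) := by field_simp; norm_num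

/-- The lower bounds telescope, since the odd numbers 1, 3, …, 2j - 1 add up to j². -/
theorem le_cumProb (hr : r ^ 2 = n) (hr64 : 64 ≤ r) {k : ℕ} (hpar : (n + k) % 2 = 0)
    (hk : k ≤ 5 * r) (hk' : r / 10 ≤ k + 1) (hlow : Real.exp (-160) / (108 * r) ≤ midProb n k)
    {j : ℕ} (hj : 600 * j ≤ n) :
    cumProb n k 0 + Real.exp (-160) / 34560 * ((j : ℝ) ^ 2 / (n : ℝ) ^ 2) ≤ cumProb n k j := by
  induction j with
  | zero => simp
  | succ j ih =>
    have h1 := ih (by omega)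
    have h2 := (cumProb_sub_bounds hr hr64 hpar hk hk' hlow hj).1
    have h3 : ((j + 1 : ℕ) : ℝ) ^ 2 / (n : ℝ) ^ 2 = (j : ℝ) ^ 2 / (n : ℝ) ^ 2
        + (2 * j + 1) / (n : ℝ) ^ 2 := by push_cast; ring
    rw [h3, mul_add]
    linarith

end

/-! ### From the walk to the sorting probability. -/

theorem probLE_add_probLE {n : ℕ} {x y : CatalanPoset n} (hxy : x ≠ y) :
    probLE x y + probLE y x = 1 := by
  have hpos : 0 < Nat.card (PosetLinearExtension (CatalanPoset n)) := by
    rw [PosetLinearExtension.card_eq]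
    exact walkCount_pos (Nat.zero_le _) (by omega)
  have hfin : Finite (PosetLinearExtension (CatalanPoset n)) := (Nat.card_pos_iff.1 hpos).2
  unfold probLE
  rw [← add_div, div_eq_one_iff_eq (by exact_mod_cast hpos.ne')]
  classical
  have hcompl : Nat.card {L : PosetLinearExtension (CatalanPoset n) // L.1 y ≤ L.1 x}
      = Nat.card {L : PosetLinearExtension (CatalanPoset n) // ¬ L.1 x ≤ L.1 y} := by
    refine Nat.card_congr (Equiv.subtypeEquivRight fun L => ?_)
    rw [not_le, lt_iff_le_and_ne]
    exact (and_iff_left fun h => hxy (L.1.injective h).symm).symm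
  rw [hcompl, ← Nat.cast_add, ← Nat.card_sum, Nat.card_congr (Equiv.sumCompl _)]

theorem sortingProbability_le {n : ℕ} {x y : CatalanPoset n} (hxy : x ≠ y) :
    sortingProbability (CatalanPoset n) ≤ |2 * probLE x y - 1| := by
  have h : |2 * probLE x y - 1| = |probLE x y - probLE y x| := by
    rw [← probLE_add_probLE hxy]
    congr 1
    ring
  rw [h]
  exact ciInf_le (f := fun p : {p : CatalanPoset n × CatalanPoset n // p.1 ≠ p.2} =>
    |probLE p.1.1 p.1.2 - probLE p.1.2 p.1.1|)
    ⟨0, by rintro _ ⟨p, rfl⟩; positivity⟩ ⟨(x, y), hxy⟩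

theorem sortingProbability_nonneg (X : Type*) [PartialOrder X] [Fintype X] :
    0 ≤ sortingProbability X :=
  Real.iInf_nonneg fun _ => abs_nonneg _

theorem sortingProbability_le_cumProb {n k m j : ℕ} (hn : n = k + 2 * m) (hj : 0 < j) (hjm : j < m) :
    sortingProbability (CatalanPoset n) ≤ |2 * cumProb n k j - 1| := by
  have hb : m + j - 1 < n := by omega
  have ha : m + j + k < n := by omega
  -- The indices differ by k + 1 and, as n = k + 2m, add up to n + 2j - 1, so the critical time is n
  -- + 2j.
  refine (sortingProbability_le (x := ((1, ⟨m + j - 1, hb⟩) : CatalanPoset n))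
    (y := (0, ⟨m + j + k, ha⟩)) (by simp)).trans (le_of_eq ?_)
  rw [probLE, PosetLinearExtension.card_eq, PosetLinearExtension.card_down_le_up _ _ k
    (by simp only; omega) (n + 2 * j) (n - 2 * j) (by simp only; omega) (by omega), cumProb]

/-- Here y = n^(1/4) and r = y². After about B y³ moves the gain is at least a constant times B²/y²,
which exceeds the initial deficit 128/y²; the bound on y keeps these moves within n/600. -/
theorem sortingProbability_catalanPoset_le {n : ℕ} {y B : ℝ} (hB : 1 ≤ B)
    (hB' : 128 ≤ Real.exp (-160) / 34560 * B) (hy : y ^ 4 = n) (hyB : 600 * (B + 1) ≤ y) :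
    sortingProbability (CatalanPoset n) ≤ 147456 * (B + 1) * (y ^ 5)⁻¹ := by
  have hy0 : 0 < y := by linarith
  have hr : (y ^ 2) ^ 2 = (n : ℝ) := by rw [← hy]; ring
  have hr64 : 64 ≤ y ^ 2 := by nlinarith
  obtain ⟨k, hpar, hk', hk, hlt, hge, hlow⟩ := exists_near_median hr hr64
  have h0 : ∑ i ∈ Finset.range (k + 1), midProb n i = cumProb n k 0 := by
    rw [sum_range_midProb, cumProb]; simp
  rw [h0] at hlt hge
  have hJ0 : B * y ^ 3 ≤ ⌈B * y ^ 3⌉₊ := Nat.le_ceil _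
  have hJ0' : (⌈B * y ^ 3⌉₊ : ℝ) < B * y ^ 3 + 1 := Nat.ceil_lt_add_one (by positivity)
  set J₀ := ⌈B * y ^ 3⌉₊
  have hy3 : 1 ≤ y ^ 3 := one_le_pow₀ (by linarith)
  have hJle : (J₀ : ℝ) ≤ (B + 1) * y ^ 3 := by linarith
  have hJn : 600 * J₀ ≤ n := by
    have : (600 : ℝ) * J₀ ≤ n := by
      rw [← hy]
      calc (600 : ℝ) * J₀ ≤ 600 * (B + 1) * y ^ 3 := by linarith
        _ ≤ y * y ^ 3 := by gcongr
        _ = y ^ 4 := by ring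
    exact_mod_cast this
  have hreach : 1 / 2 ≤ cumProb n k J₀ := by
    refine le_trans ?_ (le_cumProb hr hr64 hpar hk hk' hlow hJn)
    have h1 : 128 / y ^ 2 ≤ Real.exp (-160) / 34560 * ((J₀ : ℝ) ^ 2 / (n : ℝ) ^ 2) := by
      calc 128 / y ^ 2 ≤ Real.exp (-160) / 34560 * B / y ^ 2 := by gcongr
        _ ≤ Real.exp (-160) / 34560 * B ^ 2 / y ^ 2 := by gcongr; nlinarith
        _ = Real.exp (-160) / 34560 * ((B * y ^ 3) ^ 2 / (n : ℝ) ^ 2) := by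
          rw [← hy]; field_simp
        _ ≤ Real.exp (-160) / 34560 * ((J₀ : ℝ) ^ 2 / (n : ℝ) ^ 2) := by gcongr
    linarith
  classical
  -- At the first crossing of 1/2 the excess is at most one increment. The crossing is not at 0,
  -- where the probability is still below 1/2.
  have hex : ∃ j, 1 / 2 ≤ cumProb n k j := ⟨J₀, hreach⟩
  have hJJ : Nat.find hex ≤ J₀ := Nat.find_min' hex hreach
  have hJ := Nat.find_spec hex
  obtain ⟨j, hj⟩ : ∃ j, Nat.find hex = j + 1 := by
    refine Nat.exists_eq_succ_of_ne_zero fun h => ?_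
    rw [h] at hJ
    linarith
  have hprev : cumProb n k j < 1 / 2 := not_le.1 (Nat.find_min hex (by omega))
  rw [hj] at hJ hJJ
  have hstep := (cumProb_sub_bounds hr hr64 hpar hk hk' hlow (j := j) (by omega)).2
  have hkn : 8 * k ≤ n := by
    have : (8 : ℝ) * k ≤ n := by rw [← hr]; nlinarith
    exact_mod_cast this
  obtain ⟨m, hm⟩ : ∃ m, n = k + 2 * m := ⟨(n - k) / 2, by omega⟩
  refine (sortingProbability_le_cumProb (j := j + 1) hm (by omega) (by omega)).trans ?_
  rw [abs_of_nonneg (by linarith)]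
  have hjJ : (2 * (j : ℝ) + 1) ≤ 2 * ((B + 1) * y ^ 3) := by
    have : ((j + 1 : ℕ) : ℝ) ≤ J₀ := by exact_mod_cast hJJ
    push_cast at this
    linarith
  calc 2 * cumProb n k (j + 1) - 1 ≤ 2 * (36864 * ((2 * j + 1) / (n : ℝ) ^ 2)) := by linarith
    _ ≤ 2 * (36864 * (2 * ((B + 1) * y ^ 3) / (n : ℝ) ^ 2)) := by gcongr
    _ = 147456 * (B + 1) * (y ^ 5)⁻¹ := by rw [← hy]; field_simp; norm_num

theorem theorem1p1 :
    (fun n : ℕ => sortingProbability (CatalanPoset n)) =O[Filter.atTop]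
      (fun n : ℕ => (n : ℝ) ^ (-(5 / 4) : ℝ)) := by
  set B : ℝ := 128 * (34560 / Real.exp (-160)) + 1
  have hpos : 0 < Real.exp (-160) := Real.exp_pos _
  have hB : 1 ≤ B := by
    have : 0 ≤ 128 * (34560 / Real.exp (-160)) := by positivity
    linarith
  have hB' : 128 ≤ Real.exp (-160) / 34560 * B := by
    have : Real.exp (-160) / 34560 * B = 128 + Real.exp (-160) / 34560 := by
      simp only [B]; field_simp
    rw [this]
    have : 0 < Real.exp (-160) / 34560 := by positivity
    linarith
  have htend : Filter.Tendsto (fun n : ℕ => (n : ℝ) ^ (1 / 4 : ℝ)) Filter.atTop Filter.atTop :=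
    (tendsto_rpow_atTop (by norm_num)).comp tendsto_natCast_atTop_atTop
  refine Asymptotics.IsBigO.of_bound (147456 * (B + 1)) ?_
  filter_upwards [htend.eventually_ge_atTop (600 * (B + 1))] with n hn
  have hn0 : (0 : ℝ) ≤ n := n.cast_nonneg
  have h4 : ((n : ℝ) ^ (1 / 4 : ℝ)) ^ 4 = n := by
    rw [← Real.rpow_natCast, ← Real.rpow_mul hn0]; norm_num
  have h5 : (n : ℝ) ^ (-(5 / 4) : ℝ) = (((n : ℝ) ^ (1 / 4 : ℝ)) ^ 5)⁻¹ := by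
    rw [← Real.rpow_natCast, ← Real.rpow_mul hn0, ← Real.rpow_neg hn0]; norm_num
  rw [Real.norm_of_nonneg (sortingProbability_nonneg _), Real.norm_of_nonneg (by positivity), h5]
  exact sortingProbability_catalanPoset_le hB hB' h4 hn
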